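/- Let $\ell\ge 3$ and $S=\mathbb{C}[z_1,\dots,z_\ell]$. A hyperplane arrangement in $\mathbb{C}^\ell$ is a finite set $\mathcal{A}$ of affine hyperplanes; it is central if every $H\in\mathcal{A}$ contains the origin, and a central arrangement is essential if $\bigcap_{H\in\mathcal{A}}H=\{0\}$. A defining polynomial of $\mathcal{A}$ is $Q=\prod_{H\in\mathcal{A}}\alpha_H$, where $\alpha_H\in S$ is a polynomial of degree one with zero set $H$. For a central arrangement the Jacobian ideal $J(\mathcal{A})=J(Q)=\left(\frac{\partial Q}{\partial z_1},\dots,\frac{\partial Q}{\partial z_\ell}\right)\subseteq S$ is homogeneous, and the Jacobian scheme is the closed subscheme $\operatorname{Proj} S/J(\mathcal{A})$ of $\mathbb{CP}^{\ell-1}=\operatorname{Proj} S$. **Theorem.** Let $\mathcal{A}_1$ and $\mathcal{A}_2$ be two central and essential arrangements in $\mathbb{C}^\ell$, $\ell\ge 3$, with defining polynomials $Q_1$ and $Q_2$. Then $\mathcal{A}_1$ and $\mathcal{A}_2$ are identical, that is, $Q_1=cQ_2$ for some $c\in\mathbb{C}^*$, if and only if $\operatorname{Proj} S/J(\mathcal{A}_1)$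 and $\operatorname{Proj} S/J(\mathcal{A}_2)$ are equal as closed subschemes of $\mathbb{CP}^{\ell-1}$. -/

import Mathlib

open CategoryTheory AlgebraicGeometry
open scoped Graded HomogeneousIdeal

/-! ## The closed subscheme of `Proj A` cut out by a homogeneous ideal -/

section QuotientGrading

variable {R A : Type*} [CommRing R] [CommRing A] [Algebra R A]
  (𝒜 : ℕ → Submodule R A) [GradedAlgebra 𝒜] (I : HomogeneousIdeal 𝒜)

/-- The grading on `A ⧸ I`: its degree `i` part is the image of the degree `i` part of `A`. -/
def quotientGrading (i : ℕ) : Submodule R (A ⧸ I.toIdeal) :=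
  (𝒜 i).map (Ideal.Quotient.mkₐ R I.toIdeal).toLinearMap

theorem mk_mem_quotientGrading {i : ℕ} {a : A} (ha : a ∈ 𝒜 i) :
    Ideal.Quotient.mk I.toIdeal a ∈ quotientGrading 𝒜 I i :=
  ⟨a, ha, rfl⟩

instance quotientGrading_gradedMonoid : SetLike.GradedMonoid (quotientGrading 𝒜 I) where
  one_mem := mk_mem_quotientGrading 𝒜 I (SetLike.GradedOne.one_mem (A := 𝒜))
  mul_mem := by
    rintro i j _ _ ⟨a, ha, rfl⟩ ⟨b, hb, rfl⟩
    exact ⟨a * b, SetLike.mul_mem_graded ha hb, by simp⟩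

/-- The restriction of the quotient map to the degree `i` parts. -/
def quotientGradingMap (i : ℕ) : 𝒜 i →ₗ[R] quotientGrading 𝒜 I i :=
  (Ideal.Quotient.mkₐ R I.toIdeal).toLinearMap.restrict fun _ ha => ⟨_, ha, rfl⟩

/-- The decomposition of a class modulo `I` into homogeneous components, computed from the
homogeneous components of a representative. -/
noncomputable def quotientGradingDecompose :
    (A ⧸ I.toIdeal) →+ DirectSum ℕ fun i => quotientGrading 𝒜 I i :=
  QuotientAddGroup.lift I.toIdeal.toAddSubgroup
    ((DirectSum.map fun i => (quotientGradingMap 𝒜 I i).toAddMonoidHom).comp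
      (DirectSum.decomposeAddEquiv 𝒜).toAddMonoidHom) (by
    intro a ha
    ext i : 1
    apply Subtype.ext
    exact Ideal.Quotient.eq_zero_iff_mem.mpr (I.isHomogeneous i ha))

theorem quotientGradingDecompose_mk (a : A) :
    quotientGradingDecompose 𝒜 I (Ideal.Quotient.mk I.toIdeal a) =
      DirectSum.map (fun i => (quotientGradingMap 𝒜 I i).toAddMonoidHom)
        (DirectSum.decompose 𝒜 a) :=
  rfl

noncomputable instance quotientGrading_gradedAlgebra : GradedAlgebra (quotientGrading 𝒜 I) where
  toDecomposition := DirectSum.Decomposition.ofAddHom (quotientGrading 𝒜 I)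
    (quotientGradingDecompose 𝒜 I)
    (by
      refine AddMonoidHom.ext fun x => ?_
      obtain ⟨a, rfl⟩ := Ideal.Quotient.mk_surjective x
      induction a using DirectSum.Decomposition.inductionOn 𝒜 with
      | zero => simp
      | add a b ha hb => rw [map_add, map_add, map_add, ha, hb]
      | @homogeneous i a =>
        simp only [AddMonoidHom.comp_apply, quotientGradingDecompose_mk,
          DirectSum.decompose_coe, DirectSum.map_of, DirectSum.coeAddMonoidHom_of]
        rfl)
    (by
      ext i x : 2
      obtain ⟨_, a, ha, rfl⟩ := x
      simp only [AddMonoidHom.comp_apply, DirectSum.coeAddMonoidHom_of, AddMonoidHom.id_apply]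
      refine (quotientGradingDecompose_mk 𝒜 I a).trans ?_
      rw [DirectSum.decompose_of_mem 𝒜 ha, DirectSum.map_of]
      rfl)

/-- The quotient map `A → A ⧸ I` as a homomorphism of graded rings. -/
def quotientGradedHom : 𝒜 →+*ᵍ quotientGrading 𝒜 I where
  toRingHom := Ideal.Quotient.mk I.toIdeal
  map_mem ha := mk_mem_quotientGrading 𝒜 I ha

theorem irrelevant_le_map_quotientGradedHom :
    HomogeneousIdeal.irrelevant (quotientGrading 𝒜 I) ≤
      (HomogeneousIdeal.irrelevant 𝒜).map (quotientGradedHom 𝒜 I) := by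
  rw [HomogeneousIdeal.irrelevant_le]
  rintro i hi _ ⟨a, ha, rfl⟩
  exact Ideal.mem_map_of_mem (quotientGradedHom 𝒜 I)
    (HomogeneousIdeal.mem_irrelevant_of_mem 𝒜 hi ha)

end QuotientGrading

section ProjQuotient

universe u

variable {R A : Type u} [CommRing R] [CommRing A] [Algebra R A]
  (𝒜 : ℕ → Submodule R A) [GradedAlgebra 𝒜] (I : HomogeneousIdeal 𝒜)

/-- The scheme `Proj (A ⧸ I)`. -/
noncomputable def projQuotient : Scheme.{u} := Proj (quotientGrading 𝒜 I)

/-- The canonical morphism `Proj (A ⧸ I) ⟶ Proj A`, induced by the quotient map `A → A ⧸ I`. -/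
noncomputable def projQuotientι : projQuotient 𝒜 I ⟶ Proj 𝒜 :=
  Proj.map (quotientGradedHom 𝒜 I) (irrelevant_le_map_quotientGradedHom 𝒜 I)

theorem isPullback_projQuotientι {i : ℕ} (hi : 0 < i) {f : A} (hf : f ∈ 𝒜 i) :
    IsPullback
      (Proj.awayι (quotientGrading 𝒜 I) (quotientGradedHom 𝒜 I f)
        (mk_mem_quotientGrading 𝒜 I hf) hi)
      (Spec.map (CommRingCat.ofHom
        (HomogeneousLocalization.Away.map (quotientGradedHom 𝒜 I) f)))
      (projQuotientι 𝒜 I) (Proj.awayι 𝒜 f hf hi) := by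
  have hf' : quotientGradedHom 𝒜 I f ∈ quotientGrading 𝒜 I i := mk_mem_quotientGrading 𝒜 I hf
  have h1 : IsOpenImmersion (Proj.awayι 𝒜 f hf hi) := inferInstance
  have h2 : IsOpenImmersion
    (Proj.awayι (quotientGrading 𝒜 I) (quotientGradedHom 𝒜 I f) hf' hi) := inferInstance
  refine (@IsOpenImmersion.isPullback _ _ _ _ _ _ _ _ h2 h1
    (Proj.awayι_comp_map _ _ hi _ hf) ?_).flip
  refine (congrArg _ (Proj.opensRange_awayι 𝒜 f hf hi)).trans ?_
  exact (Proj.opensRange_awayι (quotientGrading 𝒜 I) _ hf' hi).symm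

theorem awayMap_quotientGradedHom_surjective {i : ℕ} {f : A} (hf : f ∈ 𝒜 i) :
    Function.Surjective (HomogeneousLocalization.Away.map (quotientGradedHom 𝒜 I) f) := by
  intro x
  obtain ⟨n, _, ⟨a, ha, rfl⟩, rfl⟩ := HomogeneousLocalization.Away.mk_surjective
    (quotientGrading 𝒜 I) (mk_mem_quotientGrading 𝒜 I hf) x
  exact ⟨.mk 𝒜 hf n a ha, HomogeneousLocalization.Away.map_mk _ _ _ _ _ _⟩

instance projQuotientι_isClosedImmersion : IsClosedImmersion (projQuotientι 𝒜 I) := by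
  refine IsZariskiLocalAtTarget.of_openCover (P := @IsClosedImmersion)
    (Proj.affineOpenCover 𝒜).openCover fun s => ?_
  have hpb := isPullback_projQuotientι 𝒜 I s.1.2 s.2.2
  have hc := IsClosedImmersion.spec_of_surjective (CommRingCat.ofHom
    (HomogeneousLocalization.Away.map (quotientGradedHom 𝒜 I) (s.2 : A)))
    (awayMap_quotientGradedHom_surjective 𝒜 I s.2.2)
  rw [← hpb.isoPullback_hom_snd] at hc
  have hiso : IsIso hpb.isoPullback.hom := Iso.isIso_hom hpb.isoPullback
  exact (MorphismProperty.cancel_left_of_respectsIso @IsClosedImmersion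
    hpb.isoPullback.hom _).mp hc

end ProjQuotient

/-- Two closed subschemes of `X`, given by closed immersions into `X`, are equal if there is an
isomorphism between them over `X`. -/
def EqualAsClosedSubschemes {X Z₁ Z₂ : Scheme} (i₁ : Z₁ ⟶ X) (i₂ : Z₂ ⟶ X)
    [IsClosedImmersion i₁] [IsClosedImmersion i₂] : Prop :=
  ∃ e : Z₁ ≅ Z₂, e.hom ≫ i₂ = i₁

/-! ## Hyperplane arrangements and their Jacobian schemes -/

attribute [local instance] MvPolynomial.gradedAlgebra

/-- A hyperplane arrangement in `ℂ^ℓ`: a finite set of affine subspaces of codimension one. -/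
structure HyperplaneArrangement (ℓ : ℕ) where
  hyperplanes : Finset (AffineSubspace ℂ (Fin ℓ → ℂ))
  nonempty : ∀ H ∈ hyperplanes, (H : Set (Fin ℓ → ℂ)).Nonempty
  codim_one : ∀ H ∈ hyperplanes, Module.finrank ℂ H.direction + 1 = ℓ

namespace HyperplaneArrangement

variable {ℓ : ℕ}

/-- All hyperplanes contain the origin. -/
def IsCentral (𝒜 : HyperplaneArrangement ℓ) : Prop :=
  ∀ H ∈ 𝒜.hyperplanes, (0 : Fin ℓ → ℂ) ∈ H

/-- The intersection of all hyperplanes is the origin. -/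
def IsEssential (𝒜 : HyperplaneArrangement ℓ) : Prop :=
  ⋂ H ∈ 𝒜.hyperplanes, (H : Set (Fin ℓ → ℂ)) = {0}

/-- `α` is a polynomial of degree one whose zero set is `H`. -/
def IsDefiningForm (H : AffineSubspace ℂ (Fin ℓ → ℂ)) (α : MvPolynomial (Fin ℓ) ℂ) : Prop :=
  α.totalDegree = 1 ∧ ∀ v : Fin ℓ → ℂ, v ∈ H ↔ MvPolynomial.eval v α = 0

/-- `Q` is the product of one defining linear polynomial for each hyperplane of `𝒜`. -/
def IsDefiningPolynomial (𝒜 : HyperplaneArrangement ℓ) (Q : MvPolynomial (Fin ℓ) ℂ) : Prop :=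
  ∃ α : AffineSubspace ℂ (Fin ℓ → ℂ) → MvPolynomial (Fin ℓ) ℂ,
    (∀ H ∈ 𝒜.hyperplanes, IsDefiningForm H (α H)) ∧ Q = ∏ H ∈ 𝒜.hyperplanes, α H

end HyperplaneArrangement

/-- The ideal generated by the partial derivatives of `Q`. -/
noncomputable def jacobianIdeal {ℓ : ℕ} (Q : MvPolynomial (Fin ℓ) ℂ) :
    Ideal (MvPolynomial (Fin ℓ) ℂ) :=
  Ideal.span (Set.range fun i => MvPolynomial.pderiv i Q)

theorem jacobianIdeal_isHomogeneous {ℓ n : ℕ} {Q : MvPolynomial (Fin ℓ) ℂ}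
    (hQ : Q.IsHomogeneous n) :
    (jacobianIdeal Q).IsHomogeneous (MvPolynomial.homogeneousSubmodule (Fin ℓ) ℂ) := by
  apply Ideal.homogeneous_span
  rintro _ ⟨i, rfl⟩
  exact ⟨n - 1, hQ.pderiv⟩

namespace HyperplaneArrangement

variable {ℓ : ℕ} {𝒜 : HyperplaneArrangement ℓ} {Q : MvPolynomial (Fin ℓ) ℂ}

theorem IsDefiningForm.isHomogeneous {H : AffineSubspace ℂ (Fin ℓ → ℂ)}
    {α : MvPolynomial (Fin ℓ) ℂ} (hα : IsDefiningForm H α) (h0 : (0 : Fin ℓ → ℂ) ∈ H) :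
    α.IsHomogeneous 1 := by
  intro d hd
  have hle : d.degree ≤ 1 := hα.1 ▸ MvPolynomial.le_totalDegree (MvPolynomial.mem_support_iff.2 hd)
  have hne : d.degree ≠ 0 := by
    intro h
    rw [Finsupp.degree_eq_zero_iff] at h
    subst h
    apply hd
    have := (hα.2 0).1 h0
    rwa [← MvPolynomial.constantCoeff_eq, ← MvPolynomial.eval_zero]
  change Finsupp.weight (fun _ => 1) d = 1
  rw [← Finsupp.degree_eq_weight_one]
  omega

theorem IsDefiningPolynomial.isHomogeneous (hQ : 𝒜.IsDefiningPolynomial Q) (h𝒜 : 𝒜.IsCentral) :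
    Q.IsHomogeneous 𝒜.hyperplanes.card := by
  obtain ⟨α, hα, rfl⟩ := hQ
  simpa using MvPolynomial.IsHomogeneous.prod 𝒜.hyperplanes α (fun _ => 1)
    fun H hH => (hα H hH).isHomogeneous (h𝒜 H hH)

/-- The Jacobian ideal of a central arrangement as a homogeneous ideal. -/
noncomputable def IsDefiningPolynomial.jacobianHomogeneousIdeal
    (hQ : 𝒜.IsDefiningPolynomial Q) (h𝒜 : 𝒜.IsCentral) :
    HomogeneousIdeal (MvPolynomial.homogeneousSubmodule (Fin ℓ) ℂ) :=
  ⟨jacobianIdeal Q, jacobianIdeal_isHomogeneous (hQ.isHomogeneous h𝒜)⟩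

/-- The Jacobian scheme `Proj S/J(Q)` of a central arrangement. -/
noncomputable def IsDefiningPolynomial.jacobianScheme
    (hQ : 𝒜.IsDefiningPolynomial Q) (h𝒜 : 𝒜.IsCentral) : Scheme.{0} :=
  projQuotient (MvPolynomial.homogeneousSubmodule (Fin ℓ) ℂ) (hQ.jacobianHomogeneousIdeal h𝒜)

/-- The closed immersion of the Jacobian scheme into `ℂP^(ℓ-1) = Proj ℂ[z₁, …, z_ℓ]`. -/
noncomputable abbrev IsDefiningPolynomial.jacobianSchemeι
    (hQ : 𝒜.IsDefiningPolynomial Q) (h𝒜 : 𝒜.IsCentral) :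
    hQ.jacobianScheme h𝒜 ⟶ Proj (MvPolynomial.homogeneousSubmodule (Fin ℓ) ℂ) :=
  projQuotientι (MvPolynomial.homogeneousSubmodule (Fin ℓ) ℂ) (hQ.jacobianHomogeneousIdeal h𝒜)

instance IsDefiningPolynomial.jacobianSchemeι_isClosedImmersion
    (hQ : 𝒜.IsDefiningPolynomial Q) (h𝒜 : 𝒜.IsCentral) :
    IsClosedImmersion (hQ.jacobianSchemeι h𝒜) :=
  projQuotientι_isClosedImmersion _ _

end HyperplaneArrangement

section Subspaces

variable {K V : Type*} [Field K] [AddCommGroup V] [Module K V]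

theorem Submodule.exists_mem_forall_notMem_of_not_le [Infinite K] (X : Submodule K V)
    (s : Finset (Submodule K V)) (hs : ∀ H ∈ s, ¬ X ≤ H) :
    ∃ p ∈ X, ∀ H ∈ s, p ∉ H := by
  classical
  have key := Subspace.biUnion_ne_univ_of_top_notMem (k := K) (E := X)
    (s := s.image fun H => H.comap X.subtype) (by
      intro h
      obtain ⟨H, hH, hT⟩ := Finset.mem_image.1 h
      exact hs H hH (Submodule.comap_subtype_eq_top.1 hT))
  obtain ⟨p, hp⟩ := (Set.ne_univ_iff_exists_notMem _).1 key
  refine ⟨p, p.2, fun H hH hpH => hp ?_⟩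
  simp only [Finset.mem_image, Set.iUnion_exists, Set.mem_iUnion]
  exact ⟨_, H, ⟨hH, rfl⟩, hpH⟩

variable [FiniteDimensional K V]

theorem Submodule.finrank_inf_add_two_of_ne {H H' : Submodule K V}
    (hH : Module.finrank K H + 1 = Module.finrank K V)
    (hH' : Module.finrank K H' + 1 = Module.finrank K V) (hne : H ≠ H') :
    Module.finrank K (H ⊓ H' : Submodule K V) + 2 = Module.finrank K V := by
  have h := Submodule.finrank_sup_add_finrank_inf_eq H H'
  have hlt : H < H ⊔ H' := by
    refine lt_of_le_of_ne le_sup_left fun he => hne ?_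
    have hle : H' ≤ H := by rw [he]; exact le_sup_right
    exact (Submodule.eq_of_le_of_finrank_eq hle (by omega)).symm
  have h1 := Submodule.finrank_lt_finrank_of_lt hlt
  have h2 := Submodule.finrank_le (H ⊔ H')
  omega

variable [DecidableEq (Submodule K V)]

theorem one_lt_card_image_inf {A : Finset (Submodule K V)} (hV : 3 ≤ Module.finrank K V)
    (hA : ∀ H ∈ A, Module.finrank K H + 1 = Module.finrank K V)
    (hess : ∀ v, (∀ H ∈ A, v ∈ H) → v = 0) {H : Submodule K V} (hH : H ∈ A) :
    1 < ((A.erase H).image (H ⊓ ·)).card := by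
  by_contra! hle
  obtain ⟨X, hX, hXA⟩ : ∃ X : Submodule K V, 0 < Module.finrank K X ∧ ∀ H' ∈ A, X ≤ H' := by
    have hd := hA H hH
    rcases (A.erase H).eq_empty_or_nonempty with he | ⟨H₀, hH₀⟩
    · refine ⟨H, by omega, fun H' hH' => ?_⟩
      by_cases h : H' = H
      · exact h.ge
      · have := Finset.mem_erase.2 ⟨h, hH'⟩
        simp [he] at this
    · have hd₀ := Submodule.finrank_inf_add_two_of_ne hd
        (hA H₀ (Finset.mem_of_mem_erase hH₀)) (Finset.ne_of_mem_erase hH₀).symm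
      refine ⟨H ⊓ H₀, by omega, fun H' hH' => ?_⟩
      by_cases h : H' = H
      · exact h ▸ inf_le_left
      · rw [Finset.card_le_one.1 hle _ (Finset.mem_image_of_mem _ hH₀) _
          (Finset.mem_image_of_mem _ (Finset.mem_erase.2 ⟨h, hH'⟩))]
        exact inf_le_right
  obtain ⟨x, hx, hx0⟩ := X.exists_mem_ne_zero_of_ne_bot
    (by rintro rfl; simp at hX)
  exact hx0 (hess x fun H' hH' => hXA H' hH' hx)

open Classical in
/-- At a generic point of the intersection of two hyperplanes, the hyperplanes of the two
families through that point are exactly those containing the intersection. -/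
theorem card_fiber_inf_add_one_le [Infinite K] {A B : Finset (Submodule K V)}
    (hV : 3 ≤ Module.finrank K V)
    (hA : ∀ H ∈ A, Module.finrank K H + 1 = Module.finrank K V)
    (hB : ∀ H ∈ B, Module.finrank K H + 1 = Module.finrank K V)
    (hmult : ∀ p : V, p ≠ 0 → 2 ≤ (A.filter (p ∈ ·)).card →
      (A.filter (p ∈ ·)).card ≤ (B.filter (p ∈ ·)).card)
    {H H₀ : Submodule K V} (hH : H ∈ A) (hHB : H ∉ B) (hH₀ : H₀ ∈ A.erase H) :
    ((A.erase H).filter (H ⊓ · = H ⊓ H₀)).card + 1 ≤ (B.filter (H ⊓ · = H ⊓ H₀)).card := by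
  set X := H ⊓ H₀ with hX
  have hd := Submodule.finrank_inf_add_two_of_ne (hA H hH)
    (hA H₀ (Finset.mem_of_mem_erase hH₀)) (Finset.ne_of_mem_erase hH₀).symm
  obtain ⟨p, hpX, hp⟩ := X.exists_mem_forall_notMem_of_not_le
    (insert ⊥ ((A ∪ B).filter fun H' => ¬ X ≤ H')) (by
      intro H' hH' hle
      rcases Finset.mem_insert.1 hH' with rfl | h
      · have : X = ⊥ := le_bot_iff.1 hle
        rw [← hX, this] at hd
        simp at hd
        omega
      · exact (Finset.mem_filter.1 h).2 hle)
  have hp0 : p ≠ 0 := fun h => hp ⊥ (Finset.mem_insert_self _ _) (by simp [h])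
  have hle : ∀ H' ∈ A ∪ B, p ∈ H' → X ≤ H' := by
    intro H' hH' hpH'
    by_contra h
    exact hp H' (Finset.mem_insert_of_mem (Finset.mem_filter.2 ⟨hH', h⟩)) hpH'
  have heq : ∀ H' ∈ A ∪ B, H' ≠ H → p ∈ H' → H ⊓ H' = X := by
    intro H' hH' hne hpH'
    have hd' := Submodule.finrank_inf_add_two_of_ne (hA H hH)
      ((Finset.mem_union.1 hH').elim (hA H') (hB H')) hne.symm
    exact (Submodule.eq_of_le_of_finrank_eq (le_inf inf_le_left (hle H' hH' hpH'))
      (by omega)).symm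
  have hA' : A.filter (p ∈ ·) = insert H ((A.erase H).filter (H ⊓ · = X)) := by
    ext H'
    simp only [Finset.mem_filter, Finset.mem_insert, Finset.mem_erase]
    constructor
    · rintro ⟨h1, h2⟩
      by_cases h : H' = H
      · exact Or.inl h
      · exact Or.inr ⟨⟨h, h1⟩, heq H' (Finset.mem_union_left _ h1) h h2⟩
    · rintro (rfl | ⟨⟨_, h1⟩, h2⟩)
      · exact ⟨hH, hpX.1⟩
      · rw [← h2] at hpX
        exact ⟨h1, hpX.2⟩
  have hcardA : (A.filter (p ∈ ·)).card = ((A.erase H).filter (H ⊓ · = X)).card + 1 := by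
    rw [hA', Finset.card_insert_of_notMem (by simp)]
  have hpos : 0 < ((A.erase H).filter (H ⊓ · = X)).card :=
    Finset.card_pos.2 ⟨H₀, Finset.mem_filter.2 ⟨hH₀, rfl⟩⟩
  rw [← hcardA]
  refine (hmult p hp0 (by omega)).trans (Finset.card_le_card fun H' hH' => ?_)
  obtain ⟨h1, h2⟩ := Finset.mem_filter.1 hH'
  exact Finset.mem_filter.2 ⟨h1, heq H' (Finset.mem_union_right _ h1) (by rintro rfl; exact hHB h1) h2⟩

open Classical in
theorem subset_of_forall_card_filter_mem_le [Infinite K] {A B : Finset (Submodule K V)}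
    (hV : 3 ≤ Module.finrank K V)
    (hA : ∀ H ∈ A, Module.finrank K H + 1 = Module.finrank K V)
    (hB : ∀ H ∈ B, Module.finrank K H + 1 = Module.finrank K V)
    (hess : ∀ v, (∀ H ∈ A, v ∈ H) → v = 0)
    (hmult : ∀ p : V, p ≠ 0 → 2 ≤ (A.filter (p ∈ ·)).card →
      (A.filter (p ∈ ·)).card ≤ (B.filter (p ∈ ·)).card)
    (hcard : B.card ≤ A.card) : A ⊆ B := by
  intro H hH
  by_contra hHB
  have hT := one_lt_card_image_inf hV hA hess hH
  set T := (A.erase H).image (H ⊓ ·)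
  have h1 : (A.erase H).card = ∑ X ∈ T, ((A.erase H).filter (H ⊓ · = X)).card :=
    Finset.card_eq_sum_card_image _ _
  have h2 : ∑ X ∈ T, (B.filter (H ⊓ · = X)).card ≤ B.card := by
    rw [← Finset.card_biUnion (fun X _ Y _ hXY => Finset.disjoint_filter.2
      fun H' _ h h' => hXY (h.symm.trans h'))]
    exact Finset.card_le_card (Finset.biUnion_subset.2 fun X _ => Finset.filter_subset _ _)
  have h3 : ∑ X ∈ T, (((A.erase H).filter (H ⊓ · = X)).card + 1) ≤
      ∑ X ∈ T, (B.filter (H ⊓ · = X)).card := by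
    refine Finset.sum_le_sum fun X hX => ?_
    obtain ⟨H₀, hH₀, rfl⟩ := Finset.mem_image.1 hX
    exact card_fiber_inf_add_one_le hV hA hB hmult hH hHB hH₀
  rw [Finset.sum_add_distrib, ← h1] at h3
  have h4 := Finset.card_erase_add_one hH
  simp at h3
  omega

end Subspaces

section RestrictionToLine

/-- Restriction of polynomials to the parametrized line `t ↦ p + t v`. -/
noncomputable def restrictLine {ℓ : ℕ} (p v : Fin ℓ → ℂ) :
    MvPolynomial (Fin ℓ) ℂ →ₐ[ℂ] Polynomial ℂ :=
  MvPolynomial.aeval fun i => Polynomial.C (p i) + Polynomial.X * Polynomial.C (v i)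

variable {ℓ : ℕ}

theorem MvPolynomial.IsHomogeneous.exists_eq_sum_X_mul_C {α : MvPolynomial (Fin ℓ) ℂ}
    (hα : α.IsHomogeneous 1) : ∃ c : Fin ℓ → ℂ, α = ∑ i, X i * C (c i) := by
  have h : ∀ i, ∃ c : ℂ, pderiv i α = C c := fun i =>
    ⟨_, totalDegree_eq_zero_iff_eq_C.1 ((totalDegree_zero_iff_isHomogeneous _).2 hα.pderiv)⟩
  choose c hc using h
  refine ⟨c, ?_⟩
  have := hα.sum_X_mul_pderiv
  simp only [hc, one_smul] at this
  exact this.symm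

theorem restrictLine_of_isHomogeneous_one (p v : Fin ℓ → ℂ) {α : MvPolynomial (Fin ℓ) ℂ}
    (hα : α.IsHomogeneous 1) :
    restrictLine p v α = Polynomial.C (MvPolynomial.eval p α) +
      Polynomial.X * Polynomial.C (MvPolynomial.eval v α) := by
  obtain ⟨c, rfl⟩ := hα.exists_eq_sum_X_mul_C
  simp only [restrictLine, map_sum, map_mul, MvPolynomial.aeval_X, MvPolynomial.algHom_C,
    Polynomial.algebraMap_eq, MvPolynomial.eval_X, MvPolynomial.eval_C, Finset.mul_sum,
    ← Finset.sum_add_distrib]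
  exact Finset.sum_congr rfl fun i _ => by ring

theorem derivative_restrictLine (p v : Fin ℓ → ℂ) (f : MvPolynomial (Fin ℓ) ℂ) :
    Polynomial.derivative (restrictLine p v f) =
      ∑ i, Polynomial.C (v i) * restrictLine p v (MvPolynomial.pderiv i f) := by
  induction f using MvPolynomial.induction_on with
  | C a => simp [restrictLine]
  | add f g hf hg => simp [hf, hg, mul_add, Finset.sum_add_distrib]
  | mul_X f j hf =>
    rw [map_mul, Polynomial.derivative_mul, hf]
    simp only [Derivation.leibniz, smul_eq_mul, map_add, map_mul, MvPolynomial.pderiv_X, mul_add,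
      Finset.sum_add_distrib, Finset.sum_mul]
    rw [add_comm]
    congr 1
    · rw [Finset.sum_eq_single j]
      · simp [restrictLine]; ring
      · intro i _ hij; simp [hij.symm]
      · simp
    · exact Finset.sum_congr rfl fun i _ => by ring

variable {ι : Type*} (s : Finset ι) {α : ι → MvPolynomial (Fin ℓ) ℂ}

open Classical in
theorem pderiv_prod (j : Fin ℓ) :
    MvPolynomial.pderiv j (∏ i ∈ s, α i) =
      ∑ i ∈ s, (∏ k ∈ s.erase i, α k) * MvPolynomial.pderiv j (α i) := by
  induction s using Finset.induction_on with
  | empty => simp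
  | insert a s ha ih =>
    rw [Finset.prod_insert ha, Derivation.leibniz, ih, Finset.sum_insert ha,
      Finset.erase_insert ha, add_comm, smul_eq_mul, smul_eq_mul, Finset.mul_sum]
    congr 1
    refine Finset.sum_congr rfl fun i hi => ?_
    rw [Finset.erase_insert_of_ne (by rintro rfl; exact ha hi),
      Finset.prod_insert (fun h => ha (Finset.mem_of_mem_erase h)), mul_assoc]

open Classical in
theorem X_pow_dvd_prod_restrictLine (hα : ∀ i ∈ s, (α i).IsHomogeneous 1) (p v : Fin ℓ → ℂ) :
    Polynomial.X ^ (s.filter fun i => MvPolynomial.eval p (α i) = 0).card ∣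
      restrictLine p v (∏ i ∈ s, α i) := by
  rw [map_prod, ← Finset.prod_const]
  refine (Finset.prod_dvd_prod_of_dvd _ _ fun i hi => ?_).trans
    (Finset.prod_dvd_prod_of_subset _ _ _ (Finset.filter_subset _ _))
  obtain ⟨h1, h2⟩ := Finset.mem_filter.1 hi
  rw [restrictLine_of_isHomogeneous_one p v (hα i h1), h2]
  simp

open Classical in
theorem X_pow_dvd_restrictLine_pderiv_prod (hα : ∀ i ∈ s, (α i).IsHomogeneous 1)
    (p v : Fin ℓ → ℂ) (j : Fin ℓ) :
    Polynomial.X ^ ((s.filter fun i => MvPolynomial.eval p (α i) = 0).card - 1) ∣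
      restrictLine p v (MvPolynomial.pderiv j (∏ i ∈ s, α i)) := by
  rw [pderiv_prod, map_sum]
  refine Finset.dvd_sum fun i hi => ?_
  rw [map_mul]
  refine Dvd.dvd.mul_right (dvd_trans (pow_dvd_pow _ ?_)
    (X_pow_dvd_prod_restrictLine (s.erase i) (fun k hk => hα k (Finset.mem_of_mem_erase hk)) p v)) _
  rw [Finset.filter_erase]
  exact Finset.pred_card_le_card_erase

open Classical in
theorem rootMultiplicity_restrictLine_prod (hα : ∀ i ∈ s, (α i).IsHomogeneous 1)
    (p v : Fin ℓ → ℂ) (hv : ∀ i ∈ s, MvPolynomial.eval v (α i) ≠ 0) :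
    restrictLine p v (∏ i ∈ s, α i) ≠ 0 ∧
    (restrictLine p v (∏ i ∈ s, α i)).rootMultiplicity 0 =
      (s.filter fun i => MvPolynomial.eval p (α i) = 0).card := by
  have hne : ∀ i ∈ s, restrictLine p v (α i) ≠ 0 := by
    intro i hi h
    rw [restrictLine_of_isHomogeneous_one p v (hα i hi)] at h
    have := congrArg (Polynomial.coeff · 1) h
    simp [hv i hi] at this
  have h0 : restrictLine p v (∏ i ∈ s, α i) ≠ 0 := by
    rw [map_prod]
    exact Finset.prod_ne_zero_iff.2 hne
  refine ⟨h0, ?_⟩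
  rw [map_prod] at h0 ⊢
  rw [← Polynomial.count_roots, Polynomial.roots_prod _ _ h0, Multiset.count_bind,
    Finset.card_filter]
  refine Finset.sum_congr rfl fun i hi => ?_
  rw [Polynomial.count_roots, restrictLine_of_isHomogeneous_one p v (hα i hi)]
  split_ifs with h
  · rw [← Polynomial.count_roots, h, map_zero, zero_add, mul_comm,
      Polynomial.roots_C_mul _ (hv i hi), Polynomial.roots_X, Multiset.count_singleton_self]
  · rw [Polynomial.rootMultiplicity_eq_zero]
    simpa [Polynomial.IsRoot] using h

end RestrictionToLine

open Classical in
/-- If `J(∏ β)` lies in the saturation of `J(∏ α)`, then the multiplicity of `∏ α` at a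
singular point is at most that of `∏ β`. -/
theorem card_filter_eval_eq_zero_le {ℓ : ℕ} {ι κ : Type*} {s : Finset ι} {t : Finset κ}
    {α : ι → MvPolynomial (Fin ℓ) ℂ} {β : κ → MvPolynomial (Fin ℓ) ℂ}
    (hα : ∀ i ∈ s, (α i).IsHomogeneous 1) (hβ : ∀ i ∈ t, (β i).IsHomogeneous 1)
    (ht : t.Nonempty)
    (hsat : ∀ i j, ∃ N, MvPolynomial.X i ^ N * MvPolynomial.pderiv j (∏ k ∈ t, β k) ∈
      jacobianIdeal (∏ k ∈ s, α k))
    {v : Fin ℓ → ℂ} (hv : ∀ k ∈ t, MvPolynomial.eval v (β k) ≠ 0)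
    {p : Fin ℓ → ℂ} (hp : p ≠ 0)
    (h2 : 2 ≤ (s.filter fun i => MvPolynomial.eval p (α i) = 0).card) :
    (s.filter fun i => MvPolynomial.eval p (α i) = 0).card ≤
      (t.filter fun i => MvPolynomial.eval p (β i) = 0).card := by
  set m := (s.filter fun i => MvPolynomial.eval p (α i) = 0).card with hm
  obtain ⟨hQ0, hQ⟩ := rootMultiplicity_restrictLine_prod t hβ p v hv
  rw [← hQ]
  have hhom : (∏ k ∈ t, β k).IsHomogeneous t.card := by
    simpa using MvPolynomial.IsHomogeneous.prod t β (fun _ => 1) hβ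
  obtain ⟨i, hi⟩ := Function.ne_iff.1 hp
  have hjac : ∀ f ∈ jacobianIdeal (∏ k ∈ s, α k), Polynomial.X ^ (m - 1) ∣ restrictLine p v f := by
    have : jacobianIdeal (∏ k ∈ s, α k) ≤
        (Ideal.span {(Polynomial.X : Polynomial ℂ) ^ (m - 1)}).comap (restrictLine p v) := by
      refine Ideal.span_le.2 ?_
      rintro _ ⟨j, rfl⟩
      exact Ideal.mem_span_singleton.2 (X_pow_dvd_restrictLine_pderiv_prod s hα p v j)
    exact fun f hf => Ideal.mem_span_singleton.1 (this hf)
  have hpd : ∀ j, Polynomial.X ^ (m - 1) ∣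
      restrictLine p v (MvPolynomial.pderiv j (∏ k ∈ t, β k)) := by
    intro j
    obtain ⟨N, hN⟩ := hsat i j
    have h := hjac _ hN
    rw [map_mul, map_pow] at h
    refine Polynomial.prime_X.pow_dvd_of_dvd_mul_left _ (fun hX => hi ?_) h
    have hX' := Polynomial.prime_X.dvd_of_dvd_pow hX
    simpa [restrictLine, Polynomial.X_dvd_iff] using hX'
  set q := restrictLine p v (∏ k ∈ t, β k) with hq
  have hder : Polynomial.X ^ (m - 1) ∣ Polynomial.derivative q := by
    rw [hq, derivative_restrictLine]
    exact Finset.dvd_sum fun j _ => (hpd j).mul_left _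
  have hdvd : Polynomial.X ^ (m - 1) ∣ q := by
    have h := congrArg (restrictLine p v) hhom.sum_X_mul_pderiv
    rw [map_sum, map_nsmul, ← hq, nsmul_eq_mul, ← Polynomial.C_eq_natCast] at h
    have hd : Polynomial.X ^ (m - 1) ∣ Polynomial.C (t.card : ℂ) * q := by
      rw [← h]
      exact Finset.dvd_sum fun j _ => by rw [map_mul]; exact (hpd j).mul_left _
    exact (IsUnit.dvd_mul_left (Polynomial.isUnit_C.2
      (isUnit_iff_ne_zero.2 (by exact_mod_cast ht.card_ne_zero)))).1 hd
  have hroot : q.IsRoot 0 := by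
    rw [Polynomial.IsRoot, ← Polynomial.coeff_zero_eq_eval_zero, ← Polynomial.X_dvd_iff]
    exact (dvd_pow_self _ (by omega)).trans hdvd
  have hder0 : Polynomial.derivative q ≠ 0 := by
    intro h
    rw [Polynomial.eq_C_of_derivative_eq_zero h] at hroot hQ0
    simp at hroot hQ0
    exact hQ0 hroot
  have h3 := Polynomial.derivative_rootMultiplicity_of_root hroot
  have h4 : m - 1 ≤ (Polynomial.derivative q).rootMultiplicity 0 :=
    (Polynomial.le_rootMultiplicity_iff hder0).2 (by simpa using hder)
  have h5 := (Polynomial.rootMultiplicity_pos hQ0).2 hroot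
  omega

section ProjQuotientEquality

universe u

variable {R A : Type u} [CommRing R] [CommRing A] [Algebra R A]
  {𝒜 : ℕ → Submodule R A} [GradedAlgebra 𝒜] {I J : HomogeneousIdeal 𝒜}

theorem EqualAsClosedSubschemes.symm {X Z₁ Z₂ : Scheme} {i₁ : Z₁ ⟶ X} {i₂ : Z₂ ⟶ X}
    [IsClosedImmersion i₁] [IsClosedImmersion i₂] (h : EqualAsClosedSubschemes i₁ i₂) :
    EqualAsClosedSubschemes i₂ i₁ := by
  obtain ⟨e, he⟩ := h
  exact ⟨e.symm, by simp [← he]⟩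

theorem equalAsClosedSubschemes_projQuotientι_of_eq (h : I = J) :
    EqualAsClosedSubschemes (projQuotientι 𝒜 I) (projQuotientι 𝒜 J) := by
  subst h
  exact ⟨Iso.refl _, Category.id_comp _⟩

theorem ker_awayMap_le_of_equalAsClosedSubschemes
    (h : EqualAsClosedSubschemes (projQuotientι 𝒜 I) (projQuotientι 𝒜 J))
    {i : ℕ} (hi : 0 < i) {f : A} (hf : f ∈ 𝒜 i) :
    RingHom.ker (HomogeneousLocalization.Away.map (quotientGradedHom 𝒜 J) f) ≤
      RingHom.ker (HomogeneousLocalization.Away.map (quotientGradedHom 𝒜 I) f) := by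
  obtain ⟨e, he⟩ := h
  have h₁ := isPullback_projQuotientι 𝒜 I hi hf
  have h₂ := isPullback_projQuotientι 𝒜 J hi hf
  have hw : (Proj.awayι (quotientGrading 𝒜 I) (quotientGradedHom 𝒜 I f)
      (mk_mem_quotientGrading 𝒜 I hf) hi ≫ e.hom) ≫ projQuotientι 𝒜 J =
      Spec.map (CommRingCat.ofHom (HomogeneousLocalization.Away.map (quotientGradedHom 𝒜 I) f)) ≫
        Proj.awayι 𝒜 f hf hi := by
    exact (Category.assoc _ _ _).trans ((congrArg _ he).trans h₁.w)
  obtain ⟨g, hg⟩ := Spec.map_surjective (h₂.lift _ _ hw)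
  have hfac := h₂.lift_snd _ _ hw
  rw [← hg, ← Spec.map_comp] at hfac
  have hfac' := congrArg CommRingCat.Hom.hom (Spec.map_injective hfac)
  intro x hx
  rw [RingHom.mem_ker] at hx ⊢
  have := congrArg (fun k => k x) hfac'
  simp only [CommRingCat.hom_comp, CommRingCat.hom_ofHom, RingHom.comp_apply] at this
  rw [← this]
  exact (congrArg _ hx).trans (map_zero _)

theorem exists_pow_mul_mem_of_equalAsClosedSubschemes
    (h : EqualAsClosedSubschemes (projQuotientι 𝒜 I) (projQuotientι 𝒜 J))
    {f : A} (hf : f ∈ 𝒜 1) {n : ℕ} {a : A} (ha : a ∈ 𝒜 n) (haJ : a ∈ J.toIdeal) :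
    ∃ N, f ^ N * a ∈ I.toIdeal := by
  have han : a ∈ 𝒜 (n • 1) := by simpa using ha
  have hJ : HomogeneousLocalization.Away.mk 𝒜 hf n a han ∈
      RingHom.ker (HomogeneousLocalization.Away.map (quotientGradedHom 𝒜 J) f) := by
    rw [RingHom.mem_ker, HomogeneousLocalization.Away.map_mk,
      HomogeneousLocalization.ext_iff_val, HomogeneousLocalization.Away.val_mk]
    have : quotientGradedHom 𝒜 J a = 0 := Ideal.Quotient.eq_zero_iff_mem.2 haJ
    rw [HomogeneousLocalization.val_zero, this, Localization.mk_zero]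
  have hI := ker_awayMap_le_of_equalAsClosedSubschemes h one_pos hf hJ
  rw [RingHom.mem_ker, HomogeneousLocalization.Away.map_mk,
    HomogeneousLocalization.ext_iff_val, HomogeneousLocalization.Away.val_mk,
    HomogeneousLocalization.val_zero, Localization.mk_eq_mk', IsLocalization.mk'_eq_zero_iff] at hI
  obtain ⟨⟨_, N, rfl⟩, hN⟩ := hI
  refine ⟨N, Ideal.Quotient.eq_zero_iff_mem.1 ?_⟩
  rw [map_mul, map_pow]
  exact hN

end ProjQuotientEquality

theorem AffineSubspace.mem_direction_iff_mem_of_zero_mem {K V : Type*} [Ring K] [AddCommGroup V]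
    [Module K V] {H : AffineSubspace K V} (h0 : (0 : V) ∈ H) (v : V) :
    v ∈ H.direction ↔ v ∈ H := by
  simpa using (AffineSubspace.vadd_mem_iff_mem_direction (s := H) v h0).symm

namespace HyperplaneArrangement

variable {ℓ : ℕ}

theorem IsDefiningForm.exists_eq_C_mul {H : AffineSubspace ℂ (Fin ℓ → ℂ)}
    {α β : MvPolynomial (Fin ℓ) ℂ} (hα : IsDefiningForm H α) (hβ : IsDefiningForm H β)
    (h0 : (0 : Fin ℓ → ℂ) ∈ H) : ∃ c : ℂ, c ≠ 0 ∧ α = MvPolynomial.C c * β := by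
  obtain ⟨a, ha⟩ := (hα.isHomogeneous h0).exists_eq_sum_X_mul_C
  obtain ⟨b, hb⟩ := (hβ.isHomogeneous h0).exists_eq_sum_X_mul_C
  let f : (Fin ℓ → ℂ) → Module.Dual ℂ (Fin ℓ → ℂ) := fun c => ∑ i, c i • LinearMap.proj i
  have hf : ∀ c v, f c v = MvPolynomial.eval v (∑ i, MvPolynomial.X i * MvPolynomial.C (c i)) := by
    intro c v
    simp [f, mul_comm]
  have hker : ⨅ _ : Unit, LinearMap.ker (f b) ≤ LinearMap.ker (f a) := by
    intro v hv
    rw [iInf_const, LinearMap.mem_ker, hf, ← hb, ← hβ.2] at hv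
    rwa [LinearMap.mem_ker, hf, ← ha, ← hα.2]
  have hspan := mem_span_of_iInf_ker_le_ker (L := fun _ : Unit => f b) hker
  rw [Set.range_const, Submodule.mem_span_singleton] at hspan
  obtain ⟨c, hc⟩ := hspan
  have hab : ∀ i, a i = c * b i := by
    intro i
    have := congrArg (fun g => g (Pi.single i 1)) hc
    simpa [f, Pi.single_apply, eq_comm] using this
  have heq : α = MvPolynomial.C c * β := by
    rw [ha, hb, Finset.mul_sum]
    refine Finset.sum_congr rfl fun i _ => ?_
    rw [hab, map_mul]
    ring
  refine ⟨c, ?_, heq⟩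
  rintro rfl
  have := hα.1
  simp [heq] at this

theorem IsDefiningPolynomial.exists_eq_C_mul {𝒜 : HyperplaneArrangement ℓ}
    {Q₁ Q₂ : MvPolynomial (Fin ℓ) ℂ} (h𝒜 : 𝒜.IsCentral) (hQ₁ : 𝒜.IsDefiningPolynomial Q₁)
    (hQ₂ : 𝒜.IsDefiningPolynomial Q₂) : ∃ c : ℂ, c ≠ 0 ∧ Q₁ = MvPolynomial.C c * Q₂ := by
  obtain ⟨α, hα, rfl⟩ := hQ₁
  obtain ⟨β, hβ, rfl⟩ := hQ₂
  choose! c hc0 hc using fun H hH => (hα H hH).exists_eq_C_mul (hβ H hH) (h𝒜 H hH)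
  refine ⟨∏ H ∈ 𝒜.hyperplanes, c H, Finset.prod_ne_zero_iff.2 hc0, ?_⟩
  rw [map_prod, ← Finset.prod_mul_distrib]
  exact Finset.prod_congr rfl hc

theorem IsEssential.hyperplanes_nonempty {𝒜 : HyperplaneArrangement ℓ} (hℓ : 0 < ℓ)
    (he : 𝒜.IsEssential) : 𝒜.hyperplanes.Nonempty := by
  by_contra h
  rw [Finset.not_nonempty_iff_eq_empty] at h
  have : NeZero ℓ := ⟨hℓ.ne'⟩
  have hmem : (1 : Fin ℓ → ℂ) ∈ ({0} : Set (Fin ℓ → ℂ)) := by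
    rw [← he, h]
    simp
  exact one_ne_zero hmem

theorem IsCentral.injOn_direction {𝒜 : HyperplaneArrangement ℓ}
    {s : Set (AffineSubspace ℂ (Fin ℓ → ℂ))} (h𝒜 : 𝒜.IsCentral)
    (hs : s ⊆ ↑𝒜.hyperplanes) : Set.InjOn AffineSubspace.direction s := by
  intro H hH H' hH' h
  ext v
  rw [← AffineSubspace.mem_direction_iff_mem_of_zero_mem (h𝒜 H (hs hH)), h,
    AffineSubspace.mem_direction_iff_mem_of_zero_mem (h𝒜 H' (hs hH'))]

open Classical in
theorem IsCentral.card_filter_mem_image_direction {𝒜 : HyperplaneArrangement ℓ}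
    (h𝒜 : 𝒜.IsCentral) {α : AffineSubspace ℂ (Fin ℓ → ℂ) → MvPolynomial (Fin ℓ) ℂ}
    (hα : ∀ H ∈ 𝒜.hyperplanes, IsDefiningForm H (α H)) (p : Fin ℓ → ℂ) :
    ((𝒜.hyperplanes.image AffineSubspace.direction).filter (p ∈ ·)).card =
      (𝒜.hyperplanes.filter fun H => MvPolynomial.eval p (α H) = 0).card := by
  rw [Finset.filter_image, Finset.card_image_of_injOn (h𝒜.injOn_direction
    (by exact_mod_cast Finset.filter_subset _ _))]
  congr 1
  refine Finset.filter_congr fun H hH => ?_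
  rw [AffineSubspace.mem_direction_iff_mem_of_zero_mem (h𝒜 H hH), (hα H hH).2]

theorem hyperplanes_subset_of_equalAsClosedSubschemes (hℓ : 3 ≤ ℓ)
    {𝒜₁ 𝒜₂ : HyperplaneArrangement ℓ} (hc₁ : 𝒜₁.IsCentral) (he₁ : 𝒜₁.IsEssential)
    (hc₂ : 𝒜₂.IsCentral) (he₂ : 𝒜₂.IsEssential) {Q₁ Q₂ : MvPolynomial (Fin ℓ) ℂ}
    (hQ₁ : 𝒜₁.IsDefiningPolynomial Q₁) (hQ₂ : 𝒜₂.IsDefiningPolynomial Q₂)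
    (h : EqualAsClosedSubschemes (hQ₁.jacobianSchemeι hc₁) (hQ₂.jacobianSchemeι hc₂))
    (hcard : 𝒜₂.hyperplanes.card ≤ 𝒜₁.hyperplanes.card) :
    𝒜₁.hyperplanes ⊆ 𝒜₂.hyperplanes := by
  classical
  have hsat : ∀ i j, ∃ N, MvPolynomial.X i ^ N * MvPolynomial.pderiv j Q₂ ∈ jacobianIdeal Q₁ :=
    fun i j => exists_pow_mul_mem_of_equalAsClosedSubschemes h
      (MvPolynomial.isHomogeneous_X ℂ i) (hQ₂.isHomogeneous hc₂).pderiv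
      (Ideal.subset_span ⟨j, rfl⟩)
  obtain ⟨α, hα, rfl⟩ := hQ₁
  obtain ⟨β, hβ, rfl⟩ := hQ₂
  have hrank : Module.finrank ℂ (Fin ℓ → ℂ) = ℓ := by simp
  have hcodim : ∀ 𝒜 : HyperplaneArrangement ℓ,
      ∀ H ∈ 𝒜.hyperplanes.image AffineSubspace.direction,
      Module.finrank ℂ H + 1 = Module.finrank ℂ (Fin ℓ → ℂ) := by
    intro 𝒜 H hH
    obtain ⟨H', hH', rfl⟩ := Finset.mem_image.1 hH
    rw [hrank, 𝒜.codim_one H' hH']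
  obtain ⟨v, -, hv⟩ := (⊤ : Submodule ℂ (Fin ℓ → ℂ)).exists_mem_forall_notMem_of_not_le
    (𝒜₂.hyperplanes.image AffineSubspace.direction) (by
      intro H hH hle
      have := hcodim 𝒜₂ H hH
      rw [top_le_iff.1 hle, finrank_top] at this
      omega)
  have hsub : 𝒜₁.hyperplanes.image AffineSubspace.direction ⊆
      𝒜₂.hyperplanes.image AffineSubspace.direction := by
    refine subset_of_forall_card_filter_mem_le (hrank.symm ▸ hℓ) (hcodim 𝒜₁) (hcodim 𝒜₂) ?_ ?_ ?_
    · intro v hv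
      have : v ∈ ({0} : Set (Fin ℓ → ℂ)) := by
        rw [← he₁]
        refine Set.mem_iInter₂.2 fun H hH => ?_
        exact (AffineSubspace.mem_direction_iff_mem_of_zero_mem (hc₁ H hH) v).1
          (hv _ (Finset.mem_image_of_mem _ hH))
      exact this
    · intro p hp h2
      rw [hc₁.card_filter_mem_image_direction hα] at h2 ⊢
      rw [hc₂.card_filter_mem_image_direction hβ]
      refine card_filter_eval_eq_zero_le (fun H hH => (hα H hH).isHomogeneous (hc₁ H hH))
        (fun H hH => (hβ H hH).isHomogeneous (hc₂ H hH))
        (he₂.hyperplanes_nonempty (by omega)) hsat (v := v) (fun H hH h0 => ?_) hp h2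
      refine hv _ (Finset.mem_image_of_mem _ hH) ?_
      rwa [AffineSubspace.mem_direction_iff_mem_of_zero_mem (hc₂ H hH), (hβ H hH).2]
    · rwa [Finset.card_image_of_injOn (hc₁.injOn_direction subset_rfl),
        Finset.card_image_of_injOn (hc₂.injOn_direction subset_rfl)]
  intro H hH
  obtain ⟨H', hH', hd⟩ := Finset.mem_image.1 (hsub (Finset.mem_image_of_mem _ hH))
  have : H' = H := by
    ext v
    rw [← AffineSubspace.mem_direction_iff_mem_of_zero_mem (hc₂ H' hH'), hd,
      AffineSubspace.mem_direction_iff_mem_of_zero_mem (hc₁ H hH)]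
  exact this ▸ hH'

theorem ext_hyperplanes {𝒜₁ 𝒜₂ : HyperplaneArrangement ℓ}
    (h : 𝒜₁.hyperplanes = 𝒜₂.hyperplanes) : 𝒜₁ = 𝒜₂ := by
  cases 𝒜₁
  cases 𝒜₂
  congr

end HyperplaneArrangement

theorem jacobianIdeal_C_mul {ℓ : ℕ} {c : ℂ} (hc : c ≠ 0) (Q : MvPolynomial (Fin ℓ) ℂ) :
    jacobianIdeal (MvPolynomial.C c * Q) = jacobianIdeal Q := by
  have hunit : IsUnit (MvPolynomial.C c : MvPolynomial (Fin ℓ) ℂ) :=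
    (isUnit_iff_ne_zero.2 hc).map MvPolynomial.C
  apply le_antisymm <;> refine Ideal.span_le.2 ?_ <;> rintro _ ⟨i, rfl⟩
  · rw [SetLike.mem_coe]
    beta_reduce
    rw [MvPolynomial.pderiv_C_mul]
    exact Ideal.mul_mem_left _ _ (Ideal.subset_span ⟨i, rfl⟩)
  · have : MvPolynomial.pderiv i (MvPolynomial.C c * Q) ∈ jacobianIdeal (MvPolynomial.C c * Q) :=
      Ideal.subset_span ⟨i, rfl⟩
    rwa [MvPolynomial.pderiv_C_mul,
      Ideal.unit_mul_mem_iff_mem _ hunit] at this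

theorem theorem1p1 {ℓ : ℕ} (hℓ : 3 ≤ ℓ) (𝒜₁ 𝒜₂ : HyperplaneArrangement ℓ)
    (hc₁ : 𝒜₁.IsCentral) (he₁ : 𝒜₁.IsEssential)
    (hc₂ : 𝒜₂.IsCentral) (he₂ : 𝒜₂.IsEssential)
    (Q₁ Q₂ : MvPolynomial (Fin ℓ) ℂ)
    (hQ₁ : 𝒜₁.IsDefiningPolynomial Q₁) (hQ₂ : 𝒜₂.IsDefiningPolynomial Q₂) :
    (∃ c : ℂ, c ≠ 0 ∧ Q₁ = MvPolynomial.C c * Q₂) ↔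
      EqualAsClosedSubschemes (hQ₁.jacobianSchemeι hc₁) (hQ₂.jacobianSchemeι hc₂) := by
  constructor
  · rintro ⟨c, hc, rfl⟩
    exact equalAsClosedSubschemes_projQuotientι_of_eq
      (HomogeneousIdeal.toIdeal_injective (jacobianIdeal_C_mul hc Q₂))
  · intro h
    have heq : 𝒜₁ = 𝒜₂ := by
      apply HyperplaneArrangement.ext_hyperplanes
      rcases le_total 𝒜₂.hyperplanes.card 𝒜₁.hyperplanes.card with hle | hle
      · exact Finset.eq_of_subset_of_card_le
          (HyperplaneArrangement.hyperplanes_subset_of_equalAsClosedSubschemes hℓ hc₁ he₁ hc₂ he₂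
            hQ₁ hQ₂ h hle) hle
      · exact (Finset.eq_of_subset_of_card_le
          (HyperplaneArrangement.hyperplanes_subset_of_equalAsClosedSubschemes hℓ hc₂ he₂ hc₁ he₁
            hQ₂ hQ₁ h.symm hle) hle).symm
    subst heq
    exact hQ₁.exists_eq_C_mul hc₁ hQ₂
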